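/- **Setting.** A *modular universe* $\mathcal U$ is a collection $\mathrm{Ob}(\mathcal U)$ of abelian groups (its *modules*) and a collection $\mathrm{Ar}(\mathcal U)$ of homomorphisms between them (its *compatible morphisms*), closed under composition, such that: inverses of bijective compatible morphisms are compatible; if $V_1,V_2$ are modules and $f_1,f_2$ are compatible, then $V_1\times V_2$ is a module and $f_1\times f_2$, the projections $V_1\times V_2\to V_i$ and the diagonal maps $V_1\to V_1^k$ are compatible; if $W\le V$ are modules, then $V/W$ is a module and $W\to V$, $V\to V/W$ are compatible; if $f:V_1\to V_2$ is compatible, then $\ker f$ and $\operatorname{im} f$ are modules, and for modules $W_1\le\ker f$ and $\operatorname{im} f\le W_2\le V_2$ the induced maps $V_1/W_1\to V_2$ and $V_1\to W_2$ are compatible; for every module $V$ the sum map $V\times V\to V$ and the multiplications by integers are compatible. An *additive dimension* on $\mathcal U$ is a function $\dim:\mathrm{Ob}(\mathcal U)\to\mathbb N$ with $\dim V_1=\dim\ker f+\dim\operatorname{im} f$ for every compatible $f:V_1\to V_2$. A module $V$ is *dim-connected* if $\dim W<\dim V$ for every module $W<V$. A *$G$-module in $\mathcal U$* is a module on which $G$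 acts by compatible morphisms. For $g\in G$ of finite order $m$, $\operatorname{tr}_g=1+g+\cdots+g^{m-1}$. Let $R=\mathbb Z[\phi]$ with $\phi^2=\phi+1$. For a generating set $\{\alpha,\gamma\}$ of $\mathrm{Alt}(5)$ with $|\alpha|=2$, $|\gamma|=3$, $|\alpha\gamma|=5$, let $\mathrm{Ico}(R)=Re_1\oplus Re_2\oplus Re_3$ be the $R[\mathrm{Alt}(5)]$-module with $$\alpha e_1=-e_1+\phi e_3,\quad \alpha e_2=-e_2+\phi e_3,\quad \alpha e_3=e_3,\qquad \gamma e_1=e_3,\quad \gamma e_2=e_1,\quad \gamma e_3=e_2,$$ and for an $R$-module $L$ without $2$-torsion let $\mathrm{Ico}(L)=\mathrm{Ico}(R)\otimes_R L$, with $\mathrm{Alt}(5)$ acting trivially on $L$. **Corollary D.** Let $V$ be a faithful $\mathrm{Alt}(5)$-module in a modular universe with an additive dimension. Assume that $V$ is dim-connected, that $\dim V=3$, and that $V$ has no $2$-torsion. Then $V$ is uniquely $2$-divisible, and the following holds for every involution $\alpha\in\mathrm{Alt}(5)$ and each of the two conjugacy classes $\mathcal C$ of $5$-cycles. Put $L=\operatorname{tr}_\alpha(V)$.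 Then $L$ is a module of the universe with $\dim L=1$; the endomorphism $\frac14\sum_{g\in\mathcal C}g$ of $V$ maps $L$ to itself, and its restriction $\phi\in\operatorname{End}(L)$ satisfies $\phi^2=\phi+1$, which makes $L$ a $\mathbb Z[\phi]$-module (without $2$-torsion); there is $\gamma$ of order $3$ such that $\alpha\gamma\in\mathcal C$ and $\{\alpha,\gamma\}$ generates $\mathrm{Alt}(5)$; and for every such $\gamma$, $$V\cong\mathrm{Ico}(L)$$ as $\mathrm{Alt}(5)$-modules, where $\mathrm{Ico}(L)$ is formed with respect to $\alpha,\gamma$. -/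

import Mathlib

open scoped TensorProduct

universe u v

/-! ### Modular universes and additive dimensions -/

/-- A modular universe: a collection of abelian groups (its modules, indexed by `Ob`) and of
homomorphisms between them (its compatible morphisms, `Ar`), closed under composition and under
the operations below.

A subgroup `W` of a module `V` belongs to the universe when it is the range of an injective
compatible morphism `j : X → V` from a module `X`: if `W` is itself a module, then the inclusion is
such a morphism, and conversely images of compatible morphisms are modules. Likewise, a quotient
of `V` by such a subgroup is presented by a surjective compatible morphism out of `V`. -/
structure ModularUniverse where
  /-- the modules -/
  Ob : Type v
  /-- the underlying group of a module -/
  Carrier : Ob → Type u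
  /-- the group structure -/
  addCommGroup : ∀ V, AddCommGroup (Carrier V)
  /-- the compatible morphisms -/
  Ar : ∀ {V W : Ob}, (Carrier V →+ Carrier W) → Prop
  /-- the compatible morphisms are closed under composition; identities are multiplications by 1 -/
  comp : ∀ {V₁ V₂ V₃ : Ob} (g : Carrier V₂ →+ Carrier V₃) (f : Carrier V₁ →+ Carrier V₂),
    Ar g → Ar f → Ar (g.comp f)
  /-- inverses -/
  inverse : ∀ {V₁ V₂ : Ob} (e : Carrier V₁ ≃+ Carrier V₂),
    Ar e.toAddMonoidHom → Ar e.symm.toAddMonoidHom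
  /-- the product of two modules -/
  prod : Ob → Ob → Ob
  /-- the underlying group of the product is the product of the groups -/
  prodEquiv : ∀ V₁ V₂ : Ob, Carrier (prod V₁ V₂) ≃+ Carrier V₁ × Carrier V₂
  /-- products of compatible morphisms -/
  prod_map : ∀ {V₁ V₂ W₁ W₂ : Ob} (f₁ : Carrier V₁ →+ Carrier W₁) (f₂ : Carrier V₂ →+ Carrier W₂),
    Ar f₁ → Ar f₂ → Ar ((prodEquiv W₁ W₂).symm.toAddMonoidHom.comp
      ((f₁.prodMap f₂).comp (prodEquiv V₁ V₂).toAddMonoidHom))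
  /-- first projections -/
  prod_fst : ∀ V₁ V₂ : Ob,
    Ar ((AddMonoidHom.fst (Carrier V₁) (Carrier V₂)).comp (prodEquiv V₁ V₂).toAddMonoidHom)
  /-- second projections -/
  prod_snd : ∀ V₁ V₂ : Ob,
    Ar ((AddMonoidHom.snd (Carrier V₁) (Carrier V₂)).comp (prodEquiv V₁ V₂).toAddMonoidHom)
  /-- diagonal embeddings `V → V × V`; those into higher powers are obtained by iteration -/
  diag : ∀ V : Ob, Ar ((prodEquiv V V).symm.toAddMonoidHom.comp
    ((AddMonoidHom.id (Carrier V)).prod (AddMonoidHom.id (Carrier V))))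
  /-- sections: `V / W` is a module, with compatible quotient map -/
  quotient : ∀ {W V : Ob} (j : Carrier W →+ Carrier V), Ar j → Function.Injective j →
    ∃ (Q : Ob) (q : Carrier V →+ Carrier Q), Ar q ∧ Function.Surjective q ∧ q.ker = j.range
  /-- kernels are modules -/
  ker : ∀ {V₁ V₂ : Ob} (f : Carrier V₁ →+ Carrier V₂), Ar f →
    ∃ (K : Ob) (i : Carrier K →+ Carrier V₁), Ar i ∧ Function.Injective i ∧ i.range = f.ker
  /-- images are modules -/
  im : ∀ {V₁ V₂ : Ob} (f : Carrier V₁ →+ Carrier V₂), Ar f →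
    ∃ (I : Ob) (i : Carrier I →+ Carrier V₂), Ar i ∧ Function.Injective i ∧ i.range = f.range
  /-- if `W₁ ≤ ker f` then the induced map `V₁ / W₁ → V₂` is compatible -/
  induced_quotient : ∀ {V₁ V₂ Q : Ob} (f : Carrier V₁ →+ Carrier V₂) (q : Carrier V₁ →+ Carrier Q)
    (f' : Carrier Q →+ Carrier V₂), Ar f → Ar q → Function.Surjective q → f'.comp q = f → Ar f'
  /-- if `im f ≤ W₂ ≤ V₂` then the induced map `V₁ → W₂` is compatible -/
  induced_sub : ∀ {V₁ V₂ W₂ : Ob} (f : Carrier V₁ →+ Carrier V₂) (j : Carrier W₂ →+ Carrier V₂)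
    (f' : Carrier V₁ →+ Carrier W₂), Ar f → Ar j → Function.Injective j → j.comp f' = f → Ar f'
  /-- the sum map `V × V → V` is compatible -/
  sum : ∀ V : Ob, Ar (((AddMonoidHom.id (Carrier V)).coprod (AddMonoidHom.id (Carrier V))).comp
    (prodEquiv V V).toAddMonoidHom)
  /-- multiplication by an integer is compatible -/
  mul_int : ∀ (V : Ob) (n : ℤ), Ar (zsmulAddGroupHom n : Carrier V →+ Carrier V)

attribute [instance] ModularUniverse.addCommGroup

/-- An additive dimension on a modular universe:
`dim V₁ = dim (ker f) + dim (im f)` for every compatible `f : V₁ → V₂`. -/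
structure AdditiveDim (U : ModularUniverse.{u, v}) where
  /-- the dimension of a module -/
  dim : U.Ob → ℕ
  /-- additivity, where `K` is the kernel and `I` is the image of `f` -/
  additive : ∀ {K V₁ V₂ I : U.Ob} (f : U.Carrier V₁ →+ U.Carrier V₂)
    (i : U.Carrier K →+ U.Carrier V₁) (j : U.Carrier I →+ U.Carrier V₂),
    U.Ar f → U.Ar i → Function.Injective i → i.range = f.ker →
    U.Ar j → Function.Injective j → j.range = f.range → dim V₁ = dim K + dim I

namespace AdditiveDim

variable {U : ModularUniverse.{u, v}} (d : AdditiveDim U)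

/-- `V` is dim-connected: every proper subgroup of `V` that is a module of the universe has smaller
dimension. -/
def IsDimConnected (V : U.Ob) : Prop :=
  ∀ (W : U.Ob) (j : U.Carrier W →+ U.Carrier V), U.Ar j → Function.Injective j →
    j.range < ⊤ → d.dim W < d.dim V

/-- The subgroup `W` of `V` is a module of the universe, of dimension `n`. -/
def SubgroupHasDim (V : U.Ob) (W : AddSubgroup (U.Carrier V)) (n : ℕ) : Prop :=
  ∃ (X : U.Ob) (j : U.Carrier X →+ U.Carrier V),
    U.Ar j ∧ Function.Injective j ∧ j.range = W ∧ d.dim X = n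

end AdditiveDim

/-! ### Trace maps and class sums -/

/-- The trace map `1 + g + ⋯ + g ^ (m - 1)` of an element `g` of order `m`. -/
noncomputable def traceMap {G : Type*} [Group G] (V : Type*) [AddCommGroup V] [DistribMulAction G V] (g : G) :
    V →+ V :=
  ∑ i ∈ Finset.range (orderOf g), DistribSMul.toAddMonoidHom V (g ^ i)

/-- The sum of the conjugates of `c`, as an endomorphism of `V`. -/
def classSum {G : Type*} [Group G] [Fintype G] [DecidableEq G] (V : Type*) [AddCommGroup V]
    [DistribMulAction G V] (c : G) : V →+ V :=
  ∑ g : G with IsConj c g, DistribSMul.toAddMonoidHom V g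

/-! ### The ring `ℤ[φ]` -/

/-- The alternating group on five letters. -/
abbrev Alt5 : Type := alternatingGroup (Fin 5)

/-- The ring `ℤ[φ]` with `φ ^ 2 = 1 + φ`. -/
abbrev Zphi : Type := QuadraticAlgebra ℤ 1 1

/-- The element `φ` of `ℤ[φ]`. -/
abbrev phi : Zphi := QuadraticAlgebra.omega

/-- The ring homomorphism `ℤ[φ] → End L` that maps `φ` to `f`, where `f ^ 2 = f + 1`. -/
def zphiToEnd {L : Type*} [AddCommGroup L] (f : AddMonoid.End L) (hf : f * f = f + 1) :
    Zphi →+* AddMonoid.End L :=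
  (QuadraticAlgebra.lift (R := ℤ) (a := 1) (b := 1)
    ⟨f, by rw [hf, one_smul, one_smul, add_comm]⟩).toRingHom

/-- The `ℤ[φ]`-module structure on `L` in which `φ` acts as `f`, where `f ^ 2 = f + 1`. -/
abbrev zphiModule {L : Type*} [AddCommGroup L] (f : AddMonoid.End L) (hf : f * f = f + 1) :
    Module Zphi L :=
  Module.compHom L (zphiToEnd f hf)

theorem phi_smul {L : Type*} [AddCommGroup L] (f : AddMonoid.End L) (hf : f * f = f + 1) (x : L) :
    (zphiModule f hf).toSMul.smul phi x = f x := by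
  change zphiToEnd f hf phi x = f x
  simp [zphiToEnd]

/-! ### Icosahedral modules -/

/-- `{α, γ}` is a generating set of `Alt(5)` with `|α| = 2`, `|γ| = 3` and `|αγ| = 5`. -/
structure IsIcoPair (α γ : Alt5) : Prop where
  order_left : orderOf α = 2
  order_right : orderOf γ = 3
  order_mul : orderOf (α * γ) = 5
  closure_eq : Subgroup.closure {α, γ} = ⊤

/-- The matrix by which `α` acts on the basis `e₁, e₂, e₃`: its columns are
`α e₁ = -e₁ + φ e₃`, `α e₂ = -e₂ + φ e₃`, `α e₃ = e₃`. -/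
def icoMatA : Matrix (Fin 3) (Fin 3) Zphi := !![-1, 0, 0; 0, -1, 0; phi, phi, 1]

/-- The matrix by which `γ` acts on the basis `e₁, e₂, e₃`: its columns are
`γ e₁ = e₃`, `γ e₂ = e₁`, `γ e₃ = e₂`. -/
def icoMatC : Matrix (Fin 3) (Fin 3) Zphi := !![0, 1, 0; 0, 0, 1; 1, 0, 0]

section Construction

/-- a product of two disjoint transpositions -/
def stdA : Fin 5 → Fin 5 := ![1, 0, 3, 2, 4]

/-- a `3`-cycle -/
def stdC : Fin 5 → Fin 5 := ![0, 2, 4, 3, 1]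

theorem exists_conj_left : ∀ a : Equiv.Perm (Fin 5), (∀ i, a (a i) = i) → (∃ i, a i ≠ i) →
    Equiv.Perm.sign a = 1 → ∃ s : Equiv.Perm (Fin 5), ∀ i, s (a i) = stdA (s i) := by
  decide +kernel

theorem exists_conj_right : ∀ c : Equiv.Perm (Fin 5), (∀ i, c (c (c i)) = i) → (∃ i, c i ≠ i) →
    (∀ i, stdA (c (stdA (c (stdA (c (stdA (c (stdA (c i))))))))) = i) →
    ∃ s : Equiv.Perm (Fin 5), (∀ i, s (stdA i) = stdA (s i)) ∧ ∀ i, s (c i) = stdC (s i) := by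
  decide +kernel

/-- A copy of the module inside the alternating `5 × 5` matrices: the images of `e₁, e₂, e₃`. -/
def icoForm : Fin 3 → Fin 5 → Fin 5 → Zphi :=
  ![!![0, 2 - phi, phi - 1, -1, 0;
       phi - 2, 0, 1 - phi, 0, 1;
       1 - phi, phi - 1, 0, phi - 1, 1 - phi;
       1, 0, 1 - phi, 0, phi - 2;
       0, -1, phi - 1, 2 - phi, 0],
    !![0, phi - 1, 0, -1, 2 - phi;
       1 - phi, 0, 1 - phi, phi - 1, phi - 1;
       0, phi - 1, 0, 2 - phi, -1;
       1, 1 - phi, phi - 2, 0, 0;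
       phi - 2, 1 - phi, 1, 0, 0],
    !![0, 0, 2 - phi, -1, phi - 1;
       0, 0, -1, 2 - phi, phi - 1;
       phi - 2, 1, 0, 0, 1 - phi;
       1, phi - 2, 0, 0, 1 - phi;
       1 - phi, 1 - phi, phi - 1, phi - 1, 0]]

theorem icoForm_left : ∀ k i j, ∑ l, icoForm l (stdA i) (stdA j) * icoMatA l k = icoForm k i j := by
  decide +kernel

theorem icoForm_right : ∀ k i j, ∑ l, icoForm l (stdC i) (stdC j) * icoMatC l k = icoForm k i j := by
  decide +kernel

/-- The form attached to the vector `x`, with its indices relabelled by `s`. -/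
def icoVec (s : Equiv.Perm (Fin 5)) (x : Fin 3 → Zphi) (i j : Fin 5) : Zphi :=
  ∑ k, icoForm k (s i) (s j) * x k

theorem icoVec_sub (s : Equiv.Perm (Fin 5)) (x y : Fin 3 → Zphi) (i j : Fin 5) :
    icoVec s (x - y) i j = icoVec s x i j - icoVec s y i j := by
  simp [icoVec, mul_sub, Finset.sum_sub_distrib]

theorem icoVec_injective (s : Equiv.Perm (Fin 5)) {x y : Fin 3 → Zphi}
    (h : ∀ i j, icoVec s x i j = icoVec s y i j) : x = y := by
  rw [← sub_eq_zero]
  have h0 : ∀ i j, ∑ k, icoForm k i j * (x - y) k = 0 := by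
    intro i j
    have := icoVec_sub s x y (s.symm i) (s.symm j)
    rw [h, sub_self] at this
    simpa [icoVec] using this
  generalize x - y = z at h0
  have h1 := h0 0 3
  have h2 := h0 0 1
  have h3 := h0 0 4
  have hp : phi * phi = 1 + phi := by decide
  simp [icoForm, Fin.sum_univ_three] at h1 h2 h3
  have e0 : z 0 + phi * z 1 = 0 := by
    linear_combination (1 + phi) * h2 + (z 0 - z 1) * hp
  have e1 : z 1 + phi * z 2 = 0 := by
    linear_combination (1 + phi) * h3 + (z 1 - z 2) * hp
  have e2 : z 2 + z 2 = 0 := by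
    linear_combination (-1 : Zphi) * h1 - e0 + (phi - 1) * e1 - z 2 * hp
  have z2 : z 2 = 0 := by
    have hr := congrArg QuadraticAlgebra.re e2
    have hi := congrArg QuadraticAlgebra.im e2
    simp only [QuadraticAlgebra.re_add, QuadraticAlgebra.im_add, QuadraticAlgebra.re_zero,
      QuadraticAlgebra.im_zero] at hr hi
    exact QuadraticAlgebra.ext (by simp; omega) (by simp; omega)
  have z1 : z 1 = 0 := by simpa [z2] using e1
  have z0 : z 0 = 0 := by simpa [z1] using e0
  funext k
  fin_cases k <;> assumption

theorem icoVec_mulVec (s : Equiv.Perm (Fin 5)) (g : Alt5) (t : Fin 5 → Fin 5)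
    (M : Matrix (Fin 3) (Fin 3) Zphi) (ht : ∀ i, s ((g : Equiv.Perm (Fin 5)) i) = t (s i))
    (hM : ∀ k i j, ∑ l, icoForm l (t i) (t j) * M l k = icoForm k i j) (x : Fin 3 → Zphi)
    (i j : Fin 5) :
    icoVec s (M.mulVecLin x) ((g : Equiv.Perm (Fin 5)) i) ((g : Equiv.Perm (Fin 5)) j) =
      icoVec s x i j := by
  have h1 : icoVec s x i j =
      ∑ k, (∑ l, icoForm l (t (s i)) (t (s j)) * M l k) * x k := by
    simp only [icoVec, hM]
  rw [h1]
  simp only [icoVec, ht, Matrix.mulVecLin_apply, Matrix.mulVec, dotProduct, Finset.mul_sum,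
    Finset.sum_mul, mul_assoc]
  rw [Finset.sum_comm]

theorem exists_conj (α γ : Alt5) (h : IsIcoPair α γ) : ∃ s : Equiv.Perm (Fin 5),
    (∀ i, s ((α : Equiv.Perm (Fin 5)) i) = stdA (s i)) ∧
      ∀ i, s ((γ : Equiv.Perm (Fin 5)) i) = stdC (s i) := by
  have hα : ∀ i, (α : Equiv.Perm (Fin 5)) ((α : Equiv.Perm (Fin 5)) i) = i := by
    intro i
    have := pow_orderOf_eq_one α
    rw [h.order_left] at this
    have := congrArg (fun g : Alt5 => (g : Equiv.Perm (Fin 5)) i) this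
    simpa [pow_succ] using this
  have hγ : ∀ i, (γ : Equiv.Perm (Fin 5))
      ((γ : Equiv.Perm (Fin 5)) ((γ : Equiv.Perm (Fin 5)) i)) = i := by
    intro i
    have := pow_orderOf_eq_one γ
    rw [h.order_right] at this
    have := congrArg (fun g : Alt5 => (g : Equiv.Perm (Fin 5)) i) this
    simpa [pow_succ] using this
  have hαγ : ∀ i, ((α * γ : Alt5) : Equiv.Perm (Fin 5)) (((α * γ : Alt5) : Equiv.Perm (Fin 5))
      (((α * γ : Alt5) : Equiv.Perm (Fin 5)) (((α * γ : Alt5) : Equiv.Perm (Fin 5))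
        (((α * γ : Alt5) : Equiv.Perm (Fin 5)) i)))) = i := by
    intro i
    have := pow_orderOf_eq_one (α * γ)
    rw [h.order_mul] at this
    have := congrArg (fun g : Alt5 => (g : Equiv.Perm (Fin 5)) i) this
    simpa [pow_succ] using this
  have nα : ∃ i, (α : Equiv.Perm (Fin 5)) i ≠ i := by
    by_contra! hc
    have h1 : α = 1 := Subtype.ext (Equiv.ext hc)
    have := h.order_left
    simp [h1] at this
  have nγ : ∃ i, (γ : Equiv.Perm (Fin 5)) i ≠ i := by
    by_contra! hc
    have h1 : γ = 1 := Subtype.ext (Equiv.ext hc)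
    have := h.order_right
    simp [h1] at this
  obtain ⟨s, hs⟩ := exists_conj_left α hα nα (Equiv.Perm.mem_alternatingGroup.1 α.2)
  have hs' : ∀ i, (α : Equiv.Perm (Fin 5)) (s.symm i) = s.symm (stdA i) := by
    intro i
    rw [Equiv.eq_symm_apply, hs, Equiv.apply_symm_apply]
  obtain ⟨t, ht, ht'⟩ := exists_conj_right ((s.symm.trans (γ : Equiv.Perm (Fin 5))).trans s)
    (by intro i; simp [hγ])
    (by
      obtain ⟨i, hi⟩ := nγ
      refine ⟨s i, ?_⟩
      simpa using hi)
    (by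
      intro i
      have := hαγ (s.symm i)
      simp only [Equiv.trans_apply, ← hs, Equiv.symm_apply_apply]
      rw [← Equiv.eq_symm_apply]
      simpa using this)
  refine ⟨s.trans t, fun i => ?_, fun i => ?_⟩
  · simp [hs, ht]
  · have := ht' (s i)
    simpa using this

theorem exists_icoRep (α γ : Alt5) (h : IsIcoPair α γ) :
    ∃ ρ : Alt5 →* Module.End Zphi (Fin 3 → Zphi),
      ρ α = icoMatA.mulVecLin ∧ ρ γ = icoMatC.mulVecLin := by
  obtain ⟨s, hα, hγ⟩ := exists_conj α γ h
  let P (g : Alt5) (M : Module.End Zphi (Fin 3 → Zphi)) : Prop := ∀ x i j,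
    icoVec s (M x) ((g : Equiv.Perm (Fin 5)) i) ((g : Equiv.Perm (Fin 5)) j) = icoVec s x i j
  have Pα : P α icoMatA.mulVecLin := icoVec_mulVec s α _ _ hα icoForm_left
  have Pγ : P γ icoMatC.mulVecLin := icoVec_mulVec s γ _ _ hγ icoForm_right
  have Pone : P 1 1 := fun x i j => rfl
  have Pmul : ∀ g g' M M', P g M → P g' M' → P (g * g') (M * M') := by
    intro g g' M M' hg hg' x i j
    exact (hg (M' x) _ _).trans (hg' x i j)
  have Puniq : ∀ g M M', P g M → P g M' → M = M' := by
    intro g M M' hM hM'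
    refine LinearMap.ext fun x => icoVec_injective s fun i j => ?_
    have h1 := hM x ((g : Equiv.Perm (Fin 5)).symm i) ((g : Equiv.Perm (Fin 5)).symm j)
    have h2 := hM' x ((g : Equiv.Perm (Fin 5)).symm i) ((g : Equiv.Perm (Fin 5)).symm j)
    simp only [Equiv.apply_symm_apply] at h1 h2
    rw [h1, h2]
  have Ppow : ∀ g M, P g M → ∀ n : ℕ, P (g ^ n) (M ^ n) := by
    intro g M hM n
    induction n with
    | zero => simpa using Pone
    | succ n ih => rw [pow_succ, pow_succ]; exact Pmul _ _ _ _ ih hM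
  have Pex : ∀ g, ∃ M, P g M := by
    intro g
    have hg : g ∈ Subgroup.closure {α, γ} := by rw [h.closure_eq]; trivial
    induction hg using Subgroup.closure_induction with
    | mem x hx =>
      rcases hx with rfl | rfl
      · exact ⟨_, Pα⟩
      · exact ⟨_, Pγ⟩
    | one => exact ⟨_, Pone⟩
    | mul x y _ _ hx hy =>
      obtain ⟨M, hM⟩ := hx
      obtain ⟨M', hM'⟩ := hy
      exact ⟨_, Pmul _ _ _ _ hM hM'⟩
    | inv x _ hx =>
      obtain ⟨M, hM⟩ := hx
      refine ⟨M ^ (orderOf x - 1), ?_⟩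
      have : x⁻¹ = x ^ (orderOf x - 1) := by
        rw [inv_eq_iff_mul_eq_one, ← pow_succ', Nat.sub_add_cancel (orderOf_pos x),
          pow_orderOf_eq_one]
      rw [this]
      exact Ppow _ _ hM _
  choose ρ hρ using Pex
  refine ⟨⟨⟨ρ, Puniq _ _ _ (hρ 1) Pone⟩, fun g g' =>
    Puniq _ _ _ (hρ _) (Pmul _ _ _ _ (hρ g) (hρ g'))⟩, ?_, ?_⟩
  · exact Puniq _ _ _ (hρ _) Pα
  · exact Puniq _ _ _ (hρ _) Pγ

end Construction

/-- The module `Ico(ℤ[φ])` with respect to `α, γ`: the free module `ℤ[φ] ^ 3` on which `α` and `γ`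
act by the matrices above. As `α` and `γ` generate `Alt(5)`, this determines the action. -/
noncomputable def icoRep {α γ : Alt5} (h : IsIcoPair α γ) :
    Alt5 →* Module.End Zphi (Fin 3 → Zphi) :=
  (exists_icoRep α γ h).choose

theorem icoRep_left {α γ : Alt5} (h : IsIcoPair α γ) : icoRep h α = icoMatA.mulVecLin :=
  (exists_icoRep α γ h).choose_spec.1

theorem icoRep_right {α γ : Alt5} (h : IsIcoPair α γ) : icoRep h γ = icoMatC.mulVecLin :=
  (exists_icoRep α γ h).choose_spec.2

/-- The formulas for the action of `α` and `γ` on the basis. -/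
theorem icoRep_basis {α γ : Alt5} (h : IsIcoPair α γ) :
    let e : Fin 3 → Fin 3 → Zphi := fun i => Pi.single i 1
    icoRep h α (e 0) = -e 0 + phi • e 2 ∧ icoRep h α (e 1) = -e 1 + phi • e 2 ∧
      icoRep h α (e 2) = e 2 ∧ icoRep h γ (e 0) = e 2 ∧ icoRep h γ (e 1) = e 0 ∧
      icoRep h γ (e 2) = e 1 := by
  rw [icoRep_left, icoRep_right]
  refine ⟨?_, ?_, ?_, ?_, ?_, ?_⟩ <;> ext1 i <;> fin_cases i <;>
    simp [icoMatA, icoMatC, Matrix.mulVec, dotProduct, Fin.sum_univ_three]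

/-- The underlying module of `Ico(L) = Ico(ℤ[φ]) ⊗ L`. -/
abbrev Ico (L : Type*) [AddCommGroup L] [Module Zphi L] : Type _ := (Fin 3 → Zphi) ⊗[Zphi] L

/-- The action of `Alt(5)` on `Ico(L)`, trivial on `L`. -/
noncomputable def icoAct {α γ : Alt5} (h : IsIcoPair α γ) (L : Type*) [AddCommGroup L]
    [Module Zphi L] (g : Alt5) : Ico L →ₗ[Zphi] Ico L :=
  LinearMap.rTensor L (icoRep h g)

/-- The `Alt(5)`-module `V` is isomorphic to `Ico(L)`, formed with respect to `α, γ`, where the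
element `φ` of `ℤ[φ]` acts on `L` as `f`. -/
def IsIsoIco {α γ : Alt5} (h : IsIcoPair α γ) (V : Type*) [AddCommGroup V] [DistribMulAction Alt5 V]
    {L : Type*} [AddCommGroup L] (f : AddMonoid.End L) (hf : f * f = f + 1) : Prop :=
  letI : Module Zphi L := zphiModule f hf
  ∃ e : V ≃+ Ico L, ∀ (g : Alt5) (v : V), e (g • v) = icoAct h L g (e v)

/-! Multiplication by 2 is injective, hence bijective by connectedness, so commuting involutions
split `V` into eigenspaces. Let `a`, `b` generate a Klein group whose involutions an element `t`
permutes cyclically. The three nontrivial joint eigenspaces have the same dimension `n`, and the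
common fixed part has dimension `3 - 3n`. If `n = 0`, then `a` acts trivially, against faithfulness;
so `n = 1`. The fixed points `L` of `a` have dimension 1 and the common fixed part has dimension 0,
so by connectedness the Klein trace `1 + a + b + ab` vanishes (`IsIcoFrame.trace_eq_zero_and_dim`).

The rest is algebra. Vanishing of the trace makes `b` act as `-1` on `L`. Then the sums over the
cyclic groups of orders 3 and 5 generated by `r = abcaca` and `h = bc`, both inverted by `a`, kill
`L`: such a sum is negated by an element of odd order. For `ψ = (1 + a)c` on `L` these relations
give `ψ² = ψ + 1` (`IsIcoFrame.add_smul_add_smul`) and show that the sum of the class of `ac` is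
`4ψ` (`IsIcoFrame.classSum_apply`); so `ψ` depends only on the class.

Finally `(x₁, x₂, x₃) ↦ x₃ + γx₂ + γ²x₁` is an equivariant map from `Ico(L)` to `V`. It is injective
because `2 - φ` and `1 + φ` are units and there is no 2-torsion, and surjective because `2 = (1 + a)
+ (1 + b) + (1 + ab)` on `V` (`IsIcoFrame.exists_addEquiv_ico`). -/

/-! ### Frames and generating pairs in Alt(5) -/

/-- Twelve words which list a class of `5`-cycles. -/
def icoWords {G : Type*} [Group G] (a b c : G) : List G :=
  [a * c, b * (a * b * c * a * c * a), (b * c) ^ 2].flatMap fun g =>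
    [g, a * g * a⁻¹, b * g * b⁻¹, a * b * g * (a * b)⁻¹]

/-- The relations that link `α = a` and `γ = c` to a second involution `b` of the centralizer of
`a` and an element `t` that permutes the involutions `a`, `b`, `ab` cyclically. -/
structure IsIcoFrame {G : Type*} [Group G] (a b c t : G) : Prop where
  a_sq : a * a = 1
  b_sq : b * b = 1
  comm : b * a = a * b
  conj_a : t * a = b * t
  conj_b : t * b = a * b * t
  c_cube : c * c * c = 1
  abc_sq : a * b * c * (a * b * c) = 1
  bc_pow : (b * c) ^ 5 = 1
  r_pow : (a * b * c * a * c * a) ^ 3 = 1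
  ar_sq : a * (a * b * c * a * c * a) * (a * (a * b * c * a * c * a)) = 1
  rb_pow : (a * b * c * a * c * a * b) ^ 5 = 1
  nodup : (icoWords a b c).Nodup
  isConj_iff : ∀ g, IsConj (a * c) g ↔ g ∈ icoWords a b c

theorem icoWords_map {G H : Type*} [Group G] [Group H] (e : G ≃* H) (a b c : G) :
    icoWords (e a) (e b) (e c) = (icoWords a b c).map e := by
  simp [icoWords]

theorem IsIcoFrame.map {G H : Type*} [Group G] [Group H] (e : G ≃* H) {a b c t : G}
    (h : IsIcoFrame a b c t) : IsIcoFrame (e a) (e b) (e c) (e t) where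
  a_sq := by simp only [← map_mul, h.a_sq, map_one]
  b_sq := by simp only [← map_mul, h.b_sq, map_one]
  comm := by simp only [← map_mul, h.comm]
  conj_a := by simp only [← map_mul, h.conj_a]
  conj_b := by simp only [← map_mul, h.conj_b]
  c_cube := by simp only [← map_mul, h.c_cube, map_one]
  abc_sq := by simp only [← map_mul, h.abc_sq, map_one]
  bc_pow := by simp only [← map_mul, ← map_pow, h.bc_pow, map_one]
  r_pow := by simp only [← map_mul, ← map_pow, h.r_pow, map_one]
  ar_sq := by simp only [← map_mul, h.ar_sq, map_one]
  rb_pow := by simp only [← map_mul, ← map_pow, h.rb_pow, map_one]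
  nodup := by
    rw [icoWords_map]
    exact h.nodup.map e.injective
  isConj_iff g := by
    obtain ⟨g, rfl⟩ := e.surjective g
    rw [icoWords_map, List.mem_map_of_injective e.injective, ← h.isConj_iff, ← map_mul]
    refine ⟨fun hc => ?_, fun hc => e.toMonoidHom.map_isConj hc⟩
    simpa using e.symm.toMonoidHom.map_isConj hc

/-- The product `(0 1)(2 3)`. -/
def altA : Alt5 := ⟨Equiv.swap 0 1 * Equiv.swap 2 3, Equiv.Perm.mem_alternatingGroup.2 (by decide +kernel)⟩

/-- The product `(0 2)(1 3)`. -/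
def altB : Alt5 := ⟨Equiv.swap 0 2 * Equiv.swap 1 3, Equiv.Perm.mem_alternatingGroup.2 (by decide +kernel)⟩

/-- The cycle `(1 2 4)`. -/
def altC : Alt5 := ⟨Equiv.swap 1 2 * Equiv.swap 2 4, Equiv.Perm.mem_alternatingGroup.2 (by decide +kernel)⟩

/-- The cycle `(0 2 4)`. -/
def altC' : Alt5 := ⟨Equiv.swap 0 2 * Equiv.swap 2 4, Equiv.Perm.mem_alternatingGroup.2 (by decide +kernel)⟩

/-- The cycle `(1 2 3)`. -/
def altT : Alt5 := ⟨Equiv.swap 1 2 * Equiv.swap 2 3, Equiv.Perm.mem_alternatingGroup.2 (by decide +kernel)⟩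

theorem altA_apply : ∀ i, (altA : Equiv.Perm (Fin 5)) i = stdA i := by decide +kernel

theorem altC_apply : ∀ i, (altC : Equiv.Perm (Fin 5)) i = stdC i := by decide +kernel

theorem isIcoFrame_alt : IsIcoFrame altA altB altC altT where
  a_sq := by decide +kernel
  b_sq := by decide +kernel
  comm := by decide +kernel
  conj_a := by decide +kernel
  conj_b := by decide +kernel
  c_cube := by decide +kernel
  abc_sq := by decide +kernel
  bc_pow := by decide +kernel
  r_pow := by decide +kernel
  ar_sq := by decide +kernel
  rb_pow := by decide +kernel
  nodup := by decide +kernel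
  isConj_iff := by decide +kernel

/-- All these pairs are conjugate in Sym(5), so the frame checked by computation for one pair can be
transported. An odd conjugation may swap the two classes of 5-cycles, which is harmless: a frame
refers only to the class of its own `a * c`. -/
theorem exists_isIcoFrame {α γ : Alt5} (h : IsIcoPair α γ) : ∃ β τ, IsIcoFrame α β γ τ := by
  obtain ⟨s, hα, hγ⟩ := exists_conj α γ h
  set e : Alt5 ≃* Alt5 := MulAut.conjNormal s with he
  have hA : e α = altA := by
    refine Subtype.ext (Equiv.ext fun i => ?_)
    simp [he, MulAut.conjNormal_apply, hα, altA_apply]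
  have hC : e γ = altC := by
    refine Subtype.ext (Equiv.ext fun i => ?_)
    simp [he, MulAut.conjNormal_apply, hγ, altC_apply]
  have := isIcoFrame_alt.map e.symm
  rw [← hA, ← hC, e.symm_apply_apply, e.symm_apply_apply] at this
  exact ⟨_, _, this⟩

/-- The generated subgroup has order divisible by 30, hence index at most 2; index 2 would make it
normal, against simplicity. -/
theorem isIcoPair_of_orderOf {α γ : Alt5} (h2 : orderOf α = 2) (h3 : orderOf γ = 3)
    (h5 : orderOf (α * γ) = 5) : IsIcoPair α γ := by
  refine ⟨h2, h3, h5, ?_⟩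
  set H := Subgroup.closure {α, γ} with hH
  have hα : α ∈ H := Subgroup.subset_closure (by simp)
  have hγ : γ ∈ H := Subgroup.subset_closure (by simp)
  have d2 := H.orderOf_dvd_natCard hα
  have d3 := H.orderOf_dvd_natCard hγ
  have d5 := H.orderOf_dvd_natCard (mul_mem hα hγ)
  rw [h2] at d2
  rw [h3] at d3
  rw [h5] at d5
  have hc : Nat.card H * H.index = 60 := by
    rw [H.card_mul_index, nat_card_alternatingGroup]
    simp [Nat.factorial]
  have d30 : 30 ∣ Nat.card H := by omega
  obtain ⟨k, hk⟩ := d30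
  have hki : k * H.index = 2 := by rw [hk] at hc; nlinarith
  have hi : H.index ≤ 2 := Nat.le_of_dvd two_pos ⟨k, by rw [← hki, mul_comm]⟩
  have hi0 : H.index ≠ 0 := by rintro h0; simp [h0] at hki
  obtain h1 | h1 : H.index = 1 ∨ H.index = 2 := by omega
  · exact Subgroup.index_eq_one.1 h1
  · have := Subgroup.normal_of_index_eq_two h1
    rcases this.eq_bot_or_eq_top with h0 | h0
    · rw [h0, Subgroup.mem_bot] at hα
      simp [hα] at h2
    · exact h0

/-- The two products represent the two classes of 5-cycles, so every class is reached from the same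
involution. -/
theorem isConj_altA_mul : ∀ c : Alt5, c ^ 5 = 1 → c ≠ 1 →
    IsConj c (altA * altC) ∨ IsConj c (altA * altC') := by
  decide +kernel

theorem exists_isIcoPair {α c : Alt5} (hα : orderOf α = 2) (hc : orderOf c = 5) :
    ∃ γ : Alt5, IsIcoPair α γ ∧ IsConj c (α * γ) := by
  have hα' : α * α = 1 := by rw [← pow_two, ← hα, pow_orderOf_eq_one]
  have hα1 : α ≠ 1 := by rintro rfl; simp at hα
  obtain ⟨s, hs⟩ := exists_conj_left α
    (fun i => congrArg (fun g : Alt5 => (g : Equiv.Perm (Fin 5)) i) hα')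
    (by
      by_contra! h
      exact hα1 (Subtype.ext (Equiv.ext h)))
    (Equiv.Perm.mem_alternatingGroup.1 α.2)
  set e : Alt5 ≃* Alt5 := MulAut.conjNormal s with he
  have hA : e α = altA := by
    refine Subtype.ext (Equiv.ext fun i => ?_)
    simp [he, MulAut.conjNormal_apply, hs, altA_apply]
  have key : ∀ γ₀ : Alt5, orderOf γ₀ = 3 → IsConj (e c) (altA * γ₀) →
      ∃ γ : Alt5, IsIcoPair α γ ∧ IsConj c (α * γ) := by
    intro γ₀ h3 hconj
    have h := e.symm.toMonoidHom.map_isConj hconj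
    have h' : IsConj c (α * e.symm γ₀) := by simpa [← hA] using h
    refine ⟨e.symm γ₀, isIcoPair_of_orderOf hα ?_ ?_, h'⟩
    · rw [MulEquiv.orderOf_eq, h3]
    · obtain ⟨g, hg⟩ := isConj_iff.1 h'
      rw [← hg, ← MulAut.conj_apply, MulEquiv.orderOf_eq, hc]
  have hec : orderOf (e c) = 5 := by rw [MulEquiv.orderOf_eq, hc]
  rcases isConj_altA_mul (e c) (orderOf_dvd_iff_pow_eq_one.1 hec.dvd)
    (by intro h; simp [h] at hec) with h | h
  · exact key _ (orderOf_eq_prime (by decide +kernel) (by decide +kernel)) h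
  · exact key _ (orderOf_eq_prime (by decide +kernel) (by decide +kernel)) h

/-! ### Operators on the fixed points of an involution when the Klein trace vanishes -/

theorem mul_eq_inv_mul_of_dihedral {G : Type*} [Group G] {x y : G} (hx : x * x = 1)
    (h : x * y * (x * y) = 1) : x * y = y⁻¹ * x := by
  rw [eq_inv_of_mul_eq_one_left h, mul_inv_rev, inv_eq_of_mul_eq_one_left hx]

theorem mul_inv_eq_mul_of_dihedral {G : Type*} [Group G] {x y : G} (hx : x * x = 1)
    (h : x * y * (x * y) = 1) : x * y⁻¹ = y * x := by
  rw [mul_inv_eq_iff_eq_mul, mul_assoc, mul_eq_inv_mul_of_dihedral hx h, mul_inv_cancel_left]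

theorem Odd.pow_smul_eq_neg {G A : Type*} [Group G] [AddCommGroup A] [DistribMulAction G A]
    {n : ℕ} (hn : Odd n) {g : G} {w : A} (h : g • w = -w) : g ^ n • w = -w := by
  obtain ⟨k, rfl⟩ := hn
  induction k with
  | zero => simpa using h
  | succ k ih =>
    rw [show 2 * (k + 1) + 1 = 2 * k + 1 + 1 + 1 by ring, pow_succ, pow_succ, mul_smul, mul_smul,
      h, smul_neg, h, neg_neg, ih]

/-- An odd power of `g` still negates `w`, so `w = -w`. -/
theorem eq_zero_of_odd_pow {G A : Type*} [Group G] [AddCommGroup A] [DistribMulAction G A]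
    (htors : ∀ x : A, (2 : ℕ) • x = 0 → x = 0) {n : ℕ} (hn : Odd n) {g : G} (hg : g ^ n = 1)
    {w : A} (h : g • w = -w) : w = 0 := by
  apply htors
  have := hn.pow_smul_eq_neg h
  rw [hg, one_smul] at this
  rw [two_nsmul]
  nth_rewrite 1 [this]
  exact neg_add_cancel w

namespace IsIcoFrame

variable {G A : Type*} [Group G] [AddCommGroup A] [DistribMulAction G A] {a b c t : G}

theorem a_inv (F : IsIcoFrame a b c t) : a⁻¹ = a := inv_eq_of_mul_eq_one_left F.a_sq

theorem b_inv (F : IsIcoFrame a b c t) : b⁻¹ = b := inv_eq_of_mul_eq_one_left F.b_sq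

theorem a_smul_a (F : IsIcoFrame a b c t) (v : A) : a • a • v = v := by
  rw [smul_smul, F.a_sq, one_smul]

theorem b_smul_b (F : IsIcoFrame a b c t) (v : A) : b • b • v = v := by
  rw [smul_smul, F.b_sq, one_smul]

theorem b_smul_a (F : IsIcoFrame a b c t) (v : A) : b • a • v = a • b • v := by
  rw [smul_smul, smul_smul, F.comm]

/-- On fixed points of `a` the Klein trace is `2(1 + b)`. -/
theorem smul_eq_neg (F : IsIcoFrame a b c t) (htors : ∀ x : A, (2 : ℕ) • x = 0 → x = 0)
    (hN : ∀ v : A, v + a • v + b • v + a • b • v = 0) {l : A} (hl : a • l = l) : b • l = -l := by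
  rw [← add_eq_zero_iff_eq_neg]
  apply htors
  have := hN l
  rw [← F.b_smul_a, hl] at this
  rw [← this]
  abel

/-- `(1 + a)v` is fixed by `a`, hence negated by `b`. In operator form, `(1 + a)b = -(1 + a)`. -/
theorem smul_add_smul (F : IsIcoFrame a b c t) (htors : ∀ x : A, (2 : ℕ) • x = 0 → x = 0)
    (hN : ∀ v : A, v + a • v + b • v + a • b • v = 0) (v : A) :
    b • v + a • b • v = -(v + a • v) := by
  rw [← F.b_smul_a, ← smul_add]
  apply F.smul_eq_neg htors hN
  rw [smul_add, F.a_smul_a, add_comm]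

/-- Since `a` inverts `r`, the sum `w` is fixed by `a` as well as by `r`. So `b`, and then `rb`,
negates `w`, while `(rb)^5 = 1`. -/
theorem sum_order_three (F : IsIcoFrame a b c t) (htors : ∀ x : A, (2 : ℕ) • x = 0 → x = 0)
    (hN : ∀ v : A, v + a • v + b • v + a • b • v = 0) {l : A} (hl : a • l = l) {r : G}
    (hr : r = a * b * c * a * c * a) : l + r • l + r⁻¹ • l = 0 := by
  have hr3 : r ^ 3 = 1 := hr ▸ F.r_pow
  have har : a * r * (a * r) = 1 := hr ▸ F.ar_sq
  have hrr : r * r = r⁻¹ := by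
    rw [eq_inv_iff_mul_eq_one, ← hr3, pow_succ, pow_two]
  set w := l + r • l + r⁻¹ • l with hw
  have haw : a • w = w := by
    simp only [hw, smul_add, smul_smul]
    rw [mul_eq_inv_mul_of_dihedral F.a_sq har, mul_inv_eq_mul_of_dihedral F.a_sq har, mul_smul,
      mul_smul, hl]
    abel
  have hrw : r • w = w := by
    simp only [hw, smul_add, smul_smul, hrr, mul_inv_cancel, one_smul]
    abel
  refine eq_zero_of_odd_pow htors (n := 5) (by decide) (g := r * b) (hr ▸ F.rb_pow) ?_
  rw [mul_smul, F.smul_eq_neg htors hN haw, smul_neg, hrw]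

/-- Same argument with the roles of 3 and 5 exchanged: `a` inverts `h`, and `c = bh`, whose cube is
1, negates the sum. -/
theorem sum_order_five (F : IsIcoFrame a b c t) (htors : ∀ x : A, (2 : ℕ) • x = 0 → x = 0)
    (hN : ∀ v : A, v + a • v + b • v + a • b • v = 0) {l : A} (hl : a • l = l) {h : G}
    (hh : h = b * c) : l + h • l + h⁻¹ • l + (h ^ 2) • l + (h ^ 2)⁻¹ • l = 0 := by
  have hh5 : h ^ 5 = 1 := hh ▸ F.bc_pow
  have hah : a * h * (a * h) = 1 := by
    rw [hh, ← mul_assoc a b c]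
    exact F.abc_sq
  have hh3 : h * h ^ 2 = (h ^ 2)⁻¹ := by
    rw [eq_inv_iff_mul_eq_one, ← hh5]
    group
  set w := l + h • l + h⁻¹ • l + (h ^ 2) • l + (h ^ 2)⁻¹ • l with hw
  have e1 := mul_eq_inv_mul_of_dihedral F.a_sq hah
  have e2 := mul_inv_eq_mul_of_dihedral F.a_sq hah
  have haw : a • w = w := by
    have e3 : a * h ^ 2 = (h ^ 2)⁻¹ * a := by
      rw [pow_two, ← mul_assoc, e1, mul_assoc, e1, mul_inv_rev, mul_assoc]
    have e4 : a * (h ^ 2)⁻¹ = h ^ 2 * a := by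
      rw [pow_two, mul_inv_rev, ← mul_assoc, e2, mul_assoc, e2, mul_assoc]
    simp only [hw, smul_add, smul_smul]
    rw [e1, e2, e3, e4]
    simp only [mul_smul _ a, hl]
    abel
  have hhw : h • w = w := by
    have e3 : h * (h ^ 2)⁻¹ = h⁻¹ := by group
    simp only [hw, smul_add, smul_smul, hh3, e3, mul_inv_cancel, one_smul, ← pow_two]
    abel
  refine eq_zero_of_odd_pow htors (n := 3) (by decide) (g := c) ?_ ?_
  · rw [← F.c_cube, pow_succ, pow_two]
  · have : c = b * h := by rw [hh, ← mul_assoc, F.b_sq, one_mul]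
    rw [this, mul_smul, hhw, F.smul_eq_neg htors hN haw]

/-- Here `rl + r⁻¹l = (1 + a)bcacl = -(1 + a)cacl`, so this is the relation of order 3 rewritten. -/
theorem add_smul_cac (F : IsIcoFrame a b c t) (htors : ∀ x : A, (2 : ℕ) • x = 0 → x = 0)
    (hN : ∀ v : A, v + a • v + b • v + a • b • v = 0) {l : A} (hl : a • l = l) :
    c • a • c • l + a • c • a • c • l = l := by
  have h0 := F.sum_order_three htors hN hl rfl
  set r := a * b * c * a * c * a with hr
  have h1 : r • l = a • b • c • a • c • l := by simp only [hr, mul_smul, hl]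
  have h2 : r⁻¹ • l = b • c • a • c • l := by
    nth_rewrite 1 [← hl]
    rw [smul_smul, ← mul_eq_inv_mul_of_dihedral F.a_sq F.ar_sq, mul_smul, h1, F.a_smul_a]
  have h3 := F.smul_add_smul htors hN (c • a • c • l)
  rw [h1, h2, add_assoc, add_comm (a • _), h3, add_neg_eq_zero] at h0
  exact h0.symm

/-- As `(abc)² = 1`, `c⁻¹ = abcab`, and `ab` negates `l`; then `(1 + a)b = -(1 + a)` removes the
remaining sign. -/
theorem add_smul_c_inv (F : IsIcoFrame a b c t) (htors : ∀ x : A, (2 : ℕ) • x = 0 → x = 0)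
    (hN : ∀ v : A, v + a • v + b • v + a • b • v = 0) {l : A} (hl : a • l = l) :
    c⁻¹ • l + a • c⁻¹ • l = c • l + a • c • l := by
  have h1 : c⁻¹ = a * b * c * a * b := by
    refine inv_eq_of_mul_eq_one_left ?_
    simpa only [mul_assoc] using F.abc_sq
  have h2 : c⁻¹ • l = -(a • b • c • l) := by
    rw [h1]
    simp only [mul_smul, F.smul_eq_neg htors hN hl, smul_neg, hl]
  rw [h2, smul_neg, F.a_smul_a, ← neg_add, add_comm, F.smul_add_smul htors hN, neg_neg]

theorem add_smul_c_c (F : IsIcoFrame a b c t) (htors : ∀ x : A, (2 : ℕ) • x = 0 → x = 0)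
    (hN : ∀ v : A, v + a • v + b • v + a • b • v = 0) {l : A} (hl : a • l = l) :
    c • c • l + a • c • c • l = c • l + a • c • l := by
  rw [← F.add_smul_c_inv htors hN hl, smul_smul,
    eq_inv_of_mul_eq_one_left F.c_cube]

/-- On the fixed points of `a`, the operator `(1 + a) c` is a root of `X ^ 2 = X + 1`. -/
theorem add_smul_add_smul (F : IsIcoFrame a b c t) (htors : ∀ x : A, (2 : ℕ) • x = 0 → x = 0)
    (hN : ∀ v : A, v + a • v + b • v + a • b • v = 0) {l : A} (hl : a • l = l) :
    c • (c • l + a • c • l) + a • c • (c • l + a • c • l) = c • l + a • c • l + l := by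
  simp only [smul_add]
  rw [add_add_add_comm, F.add_smul_c_c htors hN hl, F.add_smul_cac htors hN hl]

/-- Summation over the conjugates by the Klein group: `b` and `ab` negate `l`, so their terms add up
to `-(1 + a)bgl = (1 + a)gl`. -/
theorem sum_conj (F : IsIcoFrame a b c t) (htors : ∀ x : A, (2 : ℕ) • x = 0 → x = 0)
    (hN : ∀ v : A, v + a • v + b • v + a • b • v = 0) {l : A} (hl : a • l = l) (g : G) :
    g • l + (a * g * a⁻¹) • l + (b * g * b⁻¹) • l + (a * b * g * (a * b)⁻¹) • l =
      (2 : ℕ) • (g • l + a • g • l) := by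
  have hb := F.smul_eq_neg htors hN hl
  have h := F.smul_add_smul htors hN (g • l)
  rw [mul_inv_rev, F.a_inv, F.b_inv]
  simp only [mul_smul, hl, hb, smul_neg]
  rw [add_assoc, ← neg_add, h, neg_neg, two_nsmul]

/-- The list consists of the Klein conjugates of `ac`, `br` and `h²`, on which `(1 + a)g` takes the
values `ψ`, `1` and `ψ - 1` on `L`, where `ψ = (1 + a)c`. By `sum_conj` the total is `2(ψ + 1 + ψ -
1)`. -/
theorem sum_icoWords (F : IsIcoFrame a b c t) (htors : ∀ x : A, (2 : ℕ) • x = 0 → x = 0)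
    (hN : ∀ v : A, v + a • v + b • v + a • b • v = 0) {l : A} (hl : a • l = l) :
    ((icoWords a b c).map (· • l)).sum = (4 : ℕ) • (c • l + a • c • l) := by
  have h0 : ((icoWords a b c).map (· • l)).sum =
      (2 : ℕ) • ((a * c) • l + a • (a * c) • l) +
      (2 : ℕ) • ((b * (a * b * c * a * c * a)) • l + a • (b * (a * b * c * a * c * a)) • l) +
      (2 : ℕ) • ((b * c) ^ 2 • l + a • (b * c) ^ 2 • l) := by
    simp only [← F.sum_conj htors hN hl]
    simp only [icoWords, List.flatMap_cons, List.flatMap_nil, List.map_append, List.map_cons,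
      List.map_nil, List.sum_append, List.sum_cons, List.sum_nil]
    abel
  have h1 : (a * c) • l + a • (a * c) • l = c • l + a • c • l := by
    rw [mul_smul, F.a_smul_a, add_comm]
  have h2 : (b * (a * b * c * a * c * a)) • l + a • (b * (a * b * c * a * c * a)) • l = l := by
    have h := F.sum_order_three htors hN hl rfl
    set r := a * b * c * a * c * a
    have hr : r⁻¹ • l = a • r • l := by
      rw [smul_smul, mul_eq_inv_mul_of_dihedral F.a_sq F.ar_sq, mul_smul, hl]
    rw [mul_smul, F.smul_add_smul htors hN, ← hr]
    rw [add_assoc] at h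
    exact (eq_neg_of_add_eq_zero_left h).symm
  have h3 : (b * c) ^ 2 • l + a • (b * c) ^ 2 • l = c • l + a • c • l - l := by
    have h := F.sum_order_five htors hN hl rfl
    have h4 : (b * c) • l + a • (b * c) • l = -(c • l + a • c • l) := by
      rw [mul_smul, F.smul_add_smul htors hN]
    obtain ⟨k, hk⟩ : ∃ k, k = b * c := ⟨_, rfl⟩
    rw [← hk] at h h4 ⊢
    have hak : a * k * (a * k) = 1 := by
      rw [hk, ← mul_assoc a b c]
      exact F.abc_sq
    have e1 := mul_eq_inv_mul_of_dihedral F.a_sq hak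
    have hk1 : k⁻¹ • l = a • k • l := by
      rw [smul_smul, e1, mul_smul, hl]
    have hk2 : (k ^ 2)⁻¹ • l = a • k ^ 2 • l := by
      have e3 : a * k ^ 2 = (k ^ 2)⁻¹ * a := by
        rw [pow_two, ← mul_assoc, e1, mul_assoc, e1, mul_inv_rev, mul_assoc]
      rw [smul_smul, e3, mul_smul, hl]
    rw [hk1, hk2, add_assoc, add_assoc l, h4] at h
    rw [eq_neg_of_add_eq_zero_right h]
    abel
  rw [h0, h1, h2, h3, ← smul_add, ← smul_add]
  have : c • l + a • c • l + l + (c • l + a • c • l - l) = (2 : ℕ) • (c • l + a • c • l) := by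
    abel
  rw [this, smul_smul, show 2 * 2 = 4 from rfl]

theorem classSum_apply {V : Type*} [AddCommGroup V] [DistribMulAction Alt5 V] {a b c t : Alt5}
    (F : IsIcoFrame a b c t) (htors : ∀ x : V, (2 : ℕ) • x = 0 → x = 0)
    (hN : ∀ v : V, v + a • v + b • v + a • b • v = 0) {c' : Alt5} (hc : IsConj c' (a * c))
    {l : V} (hl : a • l = l) : classSum V c' l = (4 : ℕ) • (c • l + a • c • l) := by
  have hfilter : ({g | IsConj c' g} : Finset Alt5) = (icoWords a b c).toFinset := by
    ext g
    rw [List.mem_toFinset, ← F.isConj_iff, Finset.mem_filter]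
    exact ⟨fun h => hc.symm.trans h.2, fun h => ⟨Finset.mem_univ _, hc.trans h⟩⟩
  rw [← F.sum_icoWords htors hN hl, classSum, hfilter, AddMonoidHom.finsetSum_apply,
    List.sum_toFinset _ F.nodup]
  rfl

end IsIcoFrame

/-! ### Dimension of submodules and connectedness -/

namespace AdditiveDim

variable {U : ModularUniverse.{u, v}} (d : AdditiveDim U)

/-- Both presentations of the subgroup serve as the image of the same morphism, so additivity gives
them the same dimension. -/
theorem SubgroupHasDim.unique {d : AdditiveDim U} {V : U.Ob} {W : AddSubgroup (U.Carrier V)}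
    {m n : ℕ} (hm : d.SubgroupHasDim V W m) (hn : d.SubgroupHasDim V W n) : m = n := by
  obtain ⟨X, j, hj, hji, hjr, rfl⟩ := hm
  obtain ⟨Y, k, hk, hki, hkr, rfl⟩ := hn
  obtain ⟨K, i, hi, hii, hir⟩ := U.ker j hj
  have h1 := d.additive j i j hj hi hii hir hj hji rfl
  have h2 := d.additive j i k hj hi hii hir hk hki (hkr.trans hjr.symm)
  omega

theorem ar_id (V : U.Ob) : U.Ar (AddMonoidHom.id (U.Carrier V)) := by
  convert U.mul_int V 1
  ext x
  simp

theorem subgroupHasDim_top (V : U.Ob) : d.SubgroupHasDim V ⊤ (d.dim V) :=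
  ⟨V, AddMonoidHom.id _, ar_id V, Function.injective_id,
    AddMonoidHom.range_eq_top.2 Function.surjective_id, rfl⟩

theorem ar_add {V W : U.Ob} {f g : U.Carrier V →+ U.Carrier W} (hf : U.Ar f) (hg : U.Ar g) :
    U.Ar (f + g) := by
  have := U.comp _ _ (U.sum W) (U.comp _ _ (U.prod_map f g hf hg) (U.diag V))
  convert this
  ext x
  simp

/-- Additivity of the dimension for the restriction of a compatible endomorphism to a submodule. -/
theorem SubgroupHasDim.exists_ker_map {d : AdditiveDim U} {V : U.Ob}
    {W : AddSubgroup (U.Carrier V)} {n : ℕ} (hW : d.SubgroupHasDim V W n)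
    {g : U.Carrier V →+ U.Carrier V} (hg : U.Ar g) :
    ∃ k m, d.SubgroupHasDim V (W ⊓ g.ker) k ∧ d.SubgroupHasDim V (W.map g) m ∧ n = k + m := by
  obtain ⟨X, j, hj, hji, rfl, rfl⟩ := hW
  have hgj := U.comp g j hg hj
  obtain ⟨K, i, hi, hii, hir⟩ := U.ker _ hgj
  obtain ⟨I, p, hp, hpi, hpr⟩ := U.im _ hgj
  refine ⟨d.dim K, d.dim I, ⟨K, j.comp i, U.comp _ _ hj hi, hji.comp hii, ?_, rfl⟩,
    ⟨I, p, hp, hpi, ?_, rfl⟩, d.additive _ i p hgj hi hii hir hp hpi hpr⟩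
  · rw [AddMonoidHom.range_eq_map, ← AddSubgroup.map_map, ← AddMonoidHom.range_eq_map, hir]
    ext x
    simp only [AddSubgroup.mem_map, AddSubgroup.mem_inf, AddMonoidHom.mem_ker,
      AddMonoidHom.mem_range, AddMonoidHom.comp_apply]
    constructor
    · rintro ⟨y, hy, rfl⟩
      exact ⟨⟨y, rfl⟩, hy⟩
    · rintro ⟨⟨y, rfl⟩, hy⟩
      exact ⟨y, hy, rfl⟩
  · rw [hpr, AddMonoidHom.range_eq_map, ← AddSubgroup.map_map, ← AddMonoidHom.range_eq_map]

theorem SubgroupHasDim.map_injective {d : AdditiveDim U} {V : U.Ob}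
    {W : AddSubgroup (U.Carrier V)} {n : ℕ} (hW : d.SubgroupHasDim V W n)
    {g : U.Carrier V →+ U.Carrier V} (hg : U.Ar g) (hgi : Function.Injective g) :
    d.SubgroupHasDim V (W.map g) n := by
  obtain ⟨X, j, hj, hji, rfl, rfl⟩ := hW
  refine ⟨X, g.comp j, U.comp _ _ hg hj, hgi.comp hji, ?_, rfl⟩
  rw [AddMonoidHom.range_eq_map, ← AddSubgroup.map_map, ← AddMonoidHom.range_eq_map]

theorem IsDimConnected.eq_top {d : AdditiveDim U} {V : U.Ob} (h : d.IsDimConnected V)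
    {W : AddSubgroup (U.Carrier V)} (hW : d.SubgroupHasDim V W (d.dim V)) : W = ⊤ := by
  by_contra hne
  obtain ⟨X, j, hj, hji, rfl, hd⟩ := hW
  exact absurd hd (h X j hj hji (lt_top_iff_ne_top.2 hne)).ne

/-- A compatible endomorphism of a connected module whose image has dimension zero vanishes. -/
theorem IsDimConnected.eq_zero {d : AdditiveDim U} {V : U.Ob} (h : d.IsDimConnected V)
    {g : U.Carrier V →+ U.Carrier V} (hg : U.Ar g) {W : AddSubgroup (U.Carrier V)}
    (hW : d.SubgroupHasDim V W 0) (hgW : g.range = W) : g = 0 := by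
  subst hgW
  obtain ⟨k, m, hk, hm, hd⟩ := (d.subgroupHasDim_top V).exists_ker_map hg
  rw [← AddMonoidHom.range_eq_map] at hm
  rw [top_inf_eq] at hk
  obtain rfl := hm.unique hW
  rw [add_zero] at hd
  subst hd
  exact AddMonoidHom.ker_eq_top_iff.1 (h.eq_top hk)

/-- An injective compatible endomorphism of a connected module is bijective. -/
theorem IsDimConnected.surjective {d : AdditiveDim U} {V : U.Ob} (h : d.IsDimConnected V)
    {g : U.Carrier V →+ U.Carrier V} (hg : U.Ar g) (hgi : Function.Injective g) :
    Function.Surjective g := by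
  have := (d.subgroupHasDim_top V).map_injective hg hgi
  rw [← AddMonoidHom.range_eq_map] at this
  exact AddMonoidHom.range_eq_top.1 (h.eq_top this)

end AdditiveDim

/-! ### Eigenspaces of involutions and the Klein group -/

/-- The elements on which `s` acts as the sign `ε`, written as `s x = ε x`. -/
def eigenSubgroup {A : Type*} [AddCommGroup A] (s : A →+ A) (ε : ℤ) : AddSubgroup A :=
  (s - ε • AddMonoidHom.id A).ker

theorem mem_eigenSubgroup {A : Type*} [AddCommGroup A] {s : A →+ A} {ε : ℤ} {x : A} :
    x ∈ eigenSubgroup s ε ↔ s x = ε • x := by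
  simp [eigenSubgroup, AddMonoidHom.mem_ker, sub_eq_zero]

/-- A submodule that is stable under halving and under an involution `s` splits into the
eigenspaces of `s`. -/
theorem AdditiveDim.SubgroupHasDim.exists_eigen {U : ModularUniverse.{u, v}} {d : AdditiveDim U}
    {V : U.Ob} {W : AddSubgroup (U.Carrier V)} {n : ℕ} (hW : d.SubgroupHasDim V W n)
    {s : U.Carrier V →+ U.Carrier V} (hs : U.Ar s) (hss : ∀ x, s (s x) = x)
    (hsW : ∀ x ∈ W, s x ∈ W) (hhalf : ∀ x ∈ W, ∃ y ∈ W, (2 : ℕ) • y = x)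
    (htors : ∀ x : U.Carrier V, (2 : ℕ) • x = 0 → x = 0) :
    ∃ k m, d.SubgroupHasDim V (W ⊓ eigenSubgroup s (-1)) k ∧
      d.SubgroupHasDim V (W ⊓ eigenSubgroup s 1) m ∧ n = k + m := by
  -- The kernel of `s + 1` on `W` is the `-1` eigenspace; its image is the `+1` eigenspace, since a
  -- fixed `x` comes from `x / 2`.
  obtain ⟨k, m, hk, hm, hd⟩ := hW.exists_ker_map (AdditiveDim.ar_add hs (AdditiveDim.ar_id V))
  refine ⟨k, m, ?_, ?_, hd⟩
  · convert hk using 2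
    simp [eigenSubgroup]
  · convert hm using 1
    ext x
    simp only [AddSubgroup.mem_inf, AddSubgroup.mem_map, mem_eigenSubgroup, one_smul,
      AddMonoidHom.add_apply, AddMonoidHom.id_apply]
    constructor
    · rintro ⟨hx, hsx⟩
      obtain ⟨y, hy, rfl⟩ := hhalf x hx
      refine ⟨y, hy, ?_⟩
      have : s y = y := by
        rw [← sub_eq_zero]
        apply htors
        rw [smul_sub, ← map_nsmul, hsx, sub_self]
      rw [this, two_nsmul]
    · rintro ⟨y, hy, rfl⟩
      exact ⟨add_mem (hsW y hy) hy, by rw [map_add, hss, add_comm]⟩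

section KleinGroup

variable {U : ModularUniverse.{u, v}} {d : AdditiveDim U} {V : U.Ob}
  [DistribMulAction Alt5 (U.Carrier V)]

open AdditiveDim DistribSMul in
/-- In a connected module of dimension `3` with a faithful action, the Klein group `⟨a, b⟩` has
trivial trace, and the fixed points of `a` have dimension one. -/
theorem IsIcoFrame.trace_eq_zero_and_dim {a b c t : Alt5} (F : IsIcoFrame a b c t) (ha : a ≠ 1)
    (hcompat : ∀ g : Alt5, U.Ar (toAddMonoidHom (U.Carrier V) g))
    (hfaithful : FaithfulSMul Alt5 (U.Carrier V)) (hconn : d.IsDimConnected V)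
    (hdim : d.dim V = 3) (htors : ∀ x : U.Carrier V, (2 : ℕ) • x = 0 → x = 0)
    (hdiv : ∀ x : U.Carrier V, ∃ y, (2 : ℕ) • y = x) :
    (∀ v : U.Carrier V, v + a • v + b • v + a • b • v = 0) ∧
      d.SubgroupHasDim V (eigenSubgroup (toAddMonoidHom (U.Carrier V) a) 1) 1 := by
  set A := toAddMonoidHom (U.Carrier V) a
  set B := toAddMonoidHom (U.Carrier V) b
  set T := toAddMonoidHom (U.Carrier V) t
  have hA : ∀ x, A x = a • x := fun _ => rfl
  have hB : ∀ x, B x = b • x := fun _ => rfl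
  have hT : ∀ x, T x = t • x := fun _ => rfl
  have hAA : ∀ x, A (A x) = x := F.a_smul_a
  have hBB : ∀ x, B (B x) = x := F.b_smul_b
  have hBA : ∀ x, B (A x) = A (B x) := F.b_smul_a
  have hTA : ∀ x, T (A x) = B (T x) := fun x => by
    simp only [hA, hB, hT, smul_smul, F.conj_a]
  have hTB : ∀ x, T (B x) = A (B (T x)) := fun x => by
    simp only [hA, hB, hT, smul_smul, F.conj_b, mul_assoc]
  have hTi : Function.Injective T := MulAction.injective t
  have hhalf : ∀ (ε : ℤ), ∀ x ∈ eigenSubgroup A ε, ∃ y ∈ eigenSubgroup A ε, (2 : ℕ) • y = x := by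
    intro ε x hx
    obtain ⟨y, rfl⟩ := hdiv x
    refine ⟨y, ?_, rfl⟩
    rw [mem_eigenSubgroup, map_nsmul, smul_comm] at hx
    rw [mem_eigenSubgroup, ← sub_eq_zero]
    apply htors
    rw [smul_sub, hx, sub_self]
  have hstable : ∀ (ε : ℤ), ∀ x ∈ eigenSubgroup A ε, B x ∈ eigenSubgroup A ε := by
    intro ε x hx
    rw [mem_eigenSubgroup] at hx ⊢
    rw [← hBA, hx, map_zsmul]
  obtain ⟨k, m, hk, hm, hkm⟩ := (d.subgroupHasDim_top V).exists_eigen (hcompat a) hAA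
    (fun _ _ => trivial) (fun x _ => (hdiv x).imp fun y hy => ⟨trivial, hy⟩) htors
  rw [top_inf_eq] at hk hm
  obtain ⟨k₁, m₁, hk₁, hm₁, hkm₁⟩ := hk.exists_eigen (hcompat b) hBB (hstable _) (hhalf _) htors
  obtain ⟨k₂, m₂, hk₂, hm₂, hkm₂⟩ := hm.exists_eigen (hcompat b) hBB (hstable _) (hhalf _) htors
  -- `T` carries the joint sign pattern `(1, -1)` to `(-1, 1)`, and that to `(-1, -1)`, so these
  -- three eigenspaces have equal dimension.
  have hmap₁ : (eigenSubgroup A 1 ⊓ eigenSubgroup B (-1)).map T =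
      eigenSubgroup A (-1) ⊓ eigenSubgroup B 1 := by
    ext x
    obtain ⟨y, rfl⟩ := MulAction.surjective t x
    change T y ∈ _ ↔ T y ∈ _
    rw [AddSubgroup.mem_map_iff_mem hTi]
    simp only [AddSubgroup.mem_inf, mem_eigenSubgroup, one_smul, neg_smul]
    rw [← hTA, ← hTi.eq_iff (a := B y), hTB, map_neg, hTi.eq_iff]
    exact ⟨fun h => ⟨by rw [← h.2, ← hTA, h.1], h.1⟩, fun h => ⟨h.2, by rw [← hTA, h.2, h.1]⟩⟩
  have hmap₂ : (eigenSubgroup A (-1) ⊓ eigenSubgroup B 1).map T =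
      eigenSubgroup A (-1) ⊓ eigenSubgroup B (-1) := by
    ext x
    obtain ⟨y, rfl⟩ := MulAction.surjective t x
    change T y ∈ _ ↔ T y ∈ _
    rw [AddSubgroup.mem_map_iff_mem hTi]
    simp only [AddSubgroup.mem_inf, mem_eigenSubgroup, one_smul, neg_smul]
    rw [← hTA, ← hTi.eq_iff (a := A y), ← hTi.eq_iff (a := B y), hTB, map_neg, hTA]
    constructor
    · rintro ⟨h1, h2⟩
      rw [h1, map_neg, neg_eq_iff_eq_neg] at h2
      exact ⟨h2, h1⟩
    · rintro ⟨h1, h2⟩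
      exact ⟨h2, by rw [h2, map_neg, h1, neg_neg]⟩
  have e₁ := (hmap₁ ▸ hk₂.map_injective (hcompat t) hTi).unique hm₁
  have e₂ := (hmap₂ ▸ hm₁.map_injective (hcompat t) hTi).unique hk₁
  rw [hdim] at hkm
  -- Now `3 = 3 * k₁ + m₂`; a nonzero `m₂` would be 3, making the common fixed part all of `V`.
  have hm₂' : m₂ = 0 := by
    by_contra hne
    have h3 : m₂ = d.dim V := by omega
    have htop := hconn.eq_top (h3 ▸ hm₂)
    refine ha (hfaithful.eq_of_smul_eq_smul fun x => ?_)
    have hx : x ∈ eigenSubgroup A 1 ⊓ eigenSubgroup B 1 := htop ▸ AddSubgroup.mem_top x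
    rw [AddSubgroup.mem_inf, mem_eigenSubgroup, one_smul] at hx
    rw [← hA, hx.1, one_smul]
  subst hm₂'
  obtain rfl : m = 1 := by omega
  refine ⟨fun v => ?_, hm⟩
  have hrange : ((AddMonoidHom.id _ + B).comp (AddMonoidHom.id _ + A)).range =
      eigenSubgroup A 1 ⊓ eigenSubgroup B 1 := by
    ext x
    simp only [AddMonoidHom.mem_range, AddMonoidHom.comp_apply, AddMonoidHom.add_apply,
      AddMonoidHom.id_apply, AddSubgroup.mem_inf, mem_eigenSubgroup, one_smul]
    constructor
    · rintro ⟨y, rfl⟩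
      simp only [map_add, hBA, hAA, hBB]
      constructor <;> abel
    · rintro ⟨hx, hx'⟩
      -- The Klein trace multiplies a common fixed point by 4, so `x / 4` is a preimage.
      obtain ⟨y, rfl⟩ := hdiv x
      obtain ⟨z, rfl⟩ := hdiv y
      have two : ∀ {y : U.Carrier V}, (2 : ℕ) • y = 0 → y = 0 := fun {y} => htors y
      refine ⟨z, ?_⟩
      have h1 : A z = z := by
        rw [← sub_eq_zero]
        apply two
        apply two
        rw [smul_sub, smul_sub, ← map_nsmul, ← map_nsmul, hx, sub_self]
      have h2 : B z = z := by
        rw [← sub_eq_zero]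
        apply two
        apply two
        rw [smul_sub, smul_sub, ← map_nsmul, ← map_nsmul, hx', sub_self]
      rw [h1, map_add, h2]
      simp only [two_nsmul]
  have h0 := hconn.eq_zero
    (U.comp _ _ (ar_add (ar_id V) (hcompat b)) (ar_add (ar_id V) (hcompat a))) hm₂ hrange
  have := DFunLike.congr_fun h0 v
  change v + a • v + b • (v + a • v) = 0 at this
  rw [_root_.smul_add, F.b_smul_a, ← add_assoc] at this
  exact this

end KleinGroup

/-! ### The isomorphism with Ico(L) -/

theorem phi_mul_phi : phi * phi = phi + 1 := by decide

section Iso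

variable {L : Type*} [AddCommGroup L] [Module Zphi L]

/-- The coordinates of an element of `Ico(L)`. -/
noncomputable def icoCoord (L : Type*) [AddCommGroup L] [Module Zphi L] :
    Ico L ≃ₗ[Zphi] (Fin 3 → L) :=
  (TensorProduct.comm Zphi (Fin 3 → Zphi) L).trans (TensorProduct.piScalarRight Zphi Zphi L (Fin 3))

theorem icoCoord_tmul (x : Fin 3 → Zphi) (l : L) (i : Fin 3) :
    icoCoord L (x ⊗ₜ l) i = x i • l := by
  simp [icoCoord]

theorem icoCoord_icoAct_left {α γ : Alt5} (h : IsIcoPair α γ) (x : Ico L) :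
    icoCoord L (icoAct h L α x) = ![-icoCoord L x 0, -icoCoord L x 1,
      phi • icoCoord L x 0 + phi • icoCoord L x 1 + icoCoord L x 2] := by
  induction x using TensorProduct.induction_on with
  | zero =>
    ext i
    fin_cases i <;> simp
  | tmul x l =>
    ext i
    rw [icoAct, LinearMap.rTensor_tmul, icoRep_left, icoCoord_tmul]
    fin_cases i <;>
      simp [icoCoord_tmul, icoMatA, Matrix.mulVec, dotProduct, Fin.sum_univ_three, add_smul,
        mul_smul]
  | add x y hx hy =>
    ext i
    rw [map_add, map_add, hx, hy, map_add]
    fin_cases i <;> simp <;> abel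

theorem icoCoord_icoAct_right {α γ : Alt5} (h : IsIcoPair α γ) (x : Ico L) :
    icoCoord L (icoAct h L γ x) = ![icoCoord L x 1, icoCoord L x 2, icoCoord L x 0] := by
  induction x using TensorProduct.induction_on with
  | zero =>
    ext i
    fin_cases i <;> simp
  | tmul x l =>
    ext i
    rw [icoAct, LinearMap.rTensor_tmul, icoRep_right, icoCoord_tmul]
    fin_cases i <;>
      simp [icoCoord_tmul, icoMatC, Matrix.mulVec, dotProduct, Fin.sum_univ_three]
  | add x y hx hy =>
    ext i
    rw [map_add, map_add, hx, hy, map_add]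
    fin_cases i <;> simp

theorem icoAct_mul {α γ : Alt5} (h : IsIcoPair α γ) (g g' : Alt5) (x : Ico L) :
    icoAct h L (g * g') x = icoAct h L g (icoAct h L g' x) := by
  simp only [icoAct, map_mul]
  rw [Module.End.mul_eq_comp, LinearMap.rTensor_comp, LinearMap.comp_apply]

theorem icoAct_one {α γ : Alt5} (h : IsIcoPair α γ) (x : Ico L) : icoAct h L 1 x = x := by
  simp only [icoAct, map_one]
  rw [Module.End.one_eq_id, LinearMap.rTensor_id, LinearMap.id_apply]

/-- Differences of the relations give `(2 - φ)(x - y) = 0` and `(2 - φ)(y - z) = 0`, where `2 - φ`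
is a unit. Once `x = y = z`, what remains is `2(1 + φ)x = 0`, with `1 + φ = φ²` a unit. -/
theorem eq_zero_of_ico_relations (htors : ∀ x : L, (2 : ℕ) • x = 0 → x = 0) {x y z : L}
    (h1 : (2 : ℕ) • x + phi • (y + z) = 0) (h2 : (2 : ℕ) • y + phi • (z + x) = 0)
    (h3 : (2 : ℕ) • z + phi • (x + y) = 0) : x = 0 ∧ y = 0 ∧ z = 0 := by
  have hp : ∀ w : L, phi • phi • w = phi • w + w := fun w => by
    rw [smul_smul, phi_mul_phi, add_smul, one_smul]
  have key : ∀ w : L, (2 : ℕ) • w - phi • w = 0 → w = 0 := by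
    intro w hw
    -- `1 + φ` is the inverse of `2 - φ`.
    have := congrArg (fun u => u + phi • u) hw
    simp only [smul_sub, smul_comm phi (2 : ℕ), hp, smul_zero, add_zero] at this
    rw [← this, two_nsmul, two_nsmul]
    abel
  have hxy : x = y := by
    rw [← sub_eq_zero]
    apply key
    rw [← sub_eq_zero.2 (h1.trans h2.symm)]
    simp only [smul_sub, smul_add]
    abel
  have hyz : y = z := by
    rw [← sub_eq_zero]
    apply key
    rw [← sub_eq_zero.2 (h2.trans h3.symm)]
    simp only [smul_sub, smul_add]
    abel
  subst hxy hyz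
  have h4 : x + phi • x = 0 := by
    apply htors
    rw [← h1]
    simp only [smul_add, two_nsmul]
  have h5 : x = 0 := by
    have := hp x
    rwa [eq_neg_of_add_eq_zero_right h4, smul_neg, eq_neg_of_add_eq_zero_right h4, neg_neg,
      neg_add_cancel] at this
  exact ⟨h5, h5, h5⟩

variable {V : Type*} [AddCommGroup V] [DistribMulAction Alt5 V]

/-- The map `Ico(L) → V` given by an embedding of `L` into `V`. -/
noncomputable def icoToModule (γ : Alt5) (j : L →+ V) : Ico L →+ V :=
  ((j.comp (Pi.evalAddMonoidHom (fun _ : Fin 3 => L) 2) +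
    (DistribSMul.toAddMonoidHom V γ).comp (j.comp (Pi.evalAddMonoidHom (fun _ : Fin 3 => L) 1))) +
    (DistribSMul.toAddMonoidHom V (γ * γ)).comp (j.comp (Pi.evalAddMonoidHom (fun _ : Fin 3 => L) 0))).comp
    (icoCoord L).toLinearMap.toAddMonoidHom

theorem icoToModule_apply (γ : Alt5) (j : L →+ V) (x : Ico L) :
    icoToModule γ j x = j (icoCoord L x 2) + γ • j (icoCoord L x 1) +
      γ • γ • j (icoCoord L x 0) := by
  rw [← mul_smul]
  rfl

/-- In `Ico`, `e₂ = γe₃` and `e₁ = γ²e₃` with `e₃` fixed by `α`; `h1` and `h2` are the formulas for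
`αe₂` and `αe₁`. Equivariance under the two generators suffices. -/
theorem icoToModule_icoAct {α γ : Alt5} (h : IsIcoPair α γ) (j : L →+ V)
    (hfix : ∀ l, α • j l = j l) (h1 : ∀ l, γ • j l + α • γ • j l = j (phi • l))
    (h2 : ∀ l, γ • γ • j l + α • γ • γ • j l = j (phi • l)) (g : Alt5) (x : Ico L) :
    icoToModule γ j (icoAct h L g x) = g • icoToModule γ j x := by
  have hg : g ∈ Subgroup.closure {α, γ} := h.closure_eq ▸ Subgroup.mem_top g
  induction hg using Subgroup.closure_induction generalizing x with
  | mem g hg =>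
    rcases hg with rfl | rfl
    · simp only [icoToModule_apply, icoCoord_icoAct_left, smul_add, hfix]
      rw [eq_sub_of_add_eq' (h1 _), eq_sub_of_add_eq' (h2 _)]
      simp
      abel
    · have h3 : g * (g * g) = 1 := by
        have := pow_orderOf_eq_one g
        rw [h.order_right] at this
        rw [← this, pow_succ', pow_two]
      simp only [icoToModule_apply, icoCoord_icoAct_right, smul_add, smul_smul, h3, one_smul]
      simp
      abel
  | one => rw [icoAct_one, one_smul]
  | mul g g' _ _ hg hg' => rw [icoAct_mul, hg, hg', mul_smul]
  | inv g _ hg =>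
    rw [eq_inv_smul_iff, ← hg, ← icoAct_mul, mul_inv_cancel, icoAct_one]

theorem IsIcoFrame.exists_addEquiv_ico {α β γ τ : Alt5} (F : IsIcoFrame α β γ τ)
    (h : IsIcoPair α γ) (htors : ∀ x : V, (2 : ℕ) • x = 0 → x = 0)
    (hdiv : ∀ x : V, ∃ y, (2 : ℕ) • y = x)
    (hN : ∀ v : V, v + α • v + β • v + α • β • v = 0) (j : L →+ V)
    (hj : Function.Injective j) (hfix : ∀ l, α • j l = j l)
    (hrange : ∀ v, α • v = v → ∃ l, j l = v)
    (hphi : ∀ l, γ • j l + α • γ • j l = j (phi • l)) :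
    ∃ e : V ≃+ Ico L, ∀ (g : Alt5) (v : V), e (g • v) = icoAct h L g (e v) := by
  have hphi2 : ∀ l, γ • γ • j l + α • γ • γ • j l = j (phi • l) := fun l => by
    rw [F.add_smul_c_c htors hN (hfix l), hphi]
  have hact := icoToModule_icoAct h j hfix hphi hphi2
  have hγ : ∀ v : V, γ • γ • γ • v = v := fun v => by
    rw [smul_smul, smul_smul, F.c_cube, one_smul]
  have hinj : Function.Injective (icoToModule γ j) := by
    rw [injective_iff_map_eq_zero]
    intro x hx
    have htorsL : ∀ l : L, (2 : ℕ) • l = 0 → l = 0 := fun l hl =>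
      hj (by rw [map_zero]; exact htors _ (by rw [← map_nsmul, hl, map_zero]))
    -- Obtained by applying `1 + α`; applying `γ` and `γ²` to a vanishing combination beforehand
    -- gives the two cyclic variants.
    have rel : ∀ l₀ l₁ l₂ : L, j l₂ + γ • j l₁ + γ • γ • j l₀ = 0 →
        (2 : ℕ) • l₂ + phi • (l₁ + l₀) = 0 := by
      intro l₀ l₁ l₂ h0
      apply hj
      have h1 := congrArg (fun v => v + α • v) h0
      simp only [smul_add, hfix, smul_zero, add_zero] at h1
      rw [map_zero, map_add, smul_add, map_add, ← hphi l₁, ← hphi2 l₀, map_nsmul, two_nsmul, ← h1]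
      abel
    rw [icoToModule_apply] at hx
    have hx1 := congrArg (γ • ·) hx
    have hx2 := congrArg (γ • γ • ·) hx
    simp only [smul_add, hγ, smul_zero] at hx1 hx2
    obtain ⟨e2, e1, e0⟩ := eq_zero_of_ico_relations htorsL (rel _ _ _ hx)
      (rel _ _ _ ((by abel : _ = _).trans hx2)) (rel _ _ _ ((by abel : _ = _).trans hx1))
    apply (icoCoord L).injective
    ext i
    fin_cases i <;> simpa
  have hsurj : Function.Surjective (icoToModule γ j) := by
    have hfixed : ∀ v, α • v = v → v ∈ (icoToModule γ j).range := by
      intro v hv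
      obtain ⟨l, rfl⟩ := hrange v hv
      refine ⟨(icoCoord L).symm ![0, 0, l], ?_⟩
      simp [icoToModule_apply]
    have hsmul : ∀ (g : Alt5) v, v ∈ (icoToModule γ j).range → g • v ∈ (icoToModule γ j).range := by
      rintro g _ ⟨x, rfl⟩
      exact ⟨_, hact g x⟩
    -- For `s = gαg⁻¹`, the vector `(1 + s)v` is the translate by `g` of a fixed point of `α`, and
    -- the image contains all of these.
    have hconj : ∀ g s : Alt5, s * g = g * α → ∀ v : V, v + s • v ∈ (icoToModule γ j).range := by
      intro g s hs v
      have : v + s • v = g • (g⁻¹ • v + α • g⁻¹ • v) := by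
        rw [smul_add, smul_inv_smul, smul_smul g, ← hs, mul_smul, smul_inv_smul]
      rw [this]
      exact hsmul _ _ (hfixed _ (by rw [smul_add, F.a_smul_a, add_comm]))
    intro v
    obtain ⟨v, rfl⟩ := hdiv v
    have e := hN v
    -- The right side is `2v` plus the Klein trace of `v`, which vanishes.
    have : (2 : ℕ) • v = (v + α • v) + (v + β • v) + (v + (α * β) • v) := by
      rw [mul_smul, ← sub_eq_zero, ← neg_eq_zero, ← e, two_nsmul]
      abel
    rw [this]
    refine add_mem (add_mem (hconj 1 α (by simp) v) (hconj τ β F.conj_a.symm v))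
      (hconj (τ * τ) (α * β) ?_ v)
    rw [← mul_assoc, ← F.conj_b, mul_assoc, ← F.conj_a, mul_assoc]
  have hbij : Function.Bijective (icoToModule γ j) := ⟨hinj, hsurj⟩
  refine ⟨(AddEquiv.ofBijective _ hbij).symm, fun g v => ?_⟩
  obtain ⟨x, rfl⟩ := hsurj v
  rw [← hact]
  exact ((AddEquiv.ofBijective _ hbij).symm_apply_apply _).trans
    (congrArg _ ((AddEquiv.ofBijective _ hbij).symm_apply_apply x).symm)

end Iso

/-! ### The trace of an involution and the conclusion -/

theorem traceMap_apply_of_orderOf_eq_two {G : Type*} [Group G] {V : Type*} [AddCommGroup V]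
    [DistribMulAction G V] {g : G} (hg : orderOf g = 2) (v : V) :
    traceMap V g v = v + g • v := by
  simp [traceMap, hg, Finset.sum_range_succ]

theorem range_traceMap {G : Type*} [Group G] {V : Type*} [AddCommGroup V]
    [DistribMulAction G V] {g : G} (hg : orderOf g = 2)
    (htors : ∀ x : V, (2 : ℕ) • x = 0 → x = 0) (hdiv : ∀ x : V, ∃ y, (2 : ℕ) • y = x) :
    (traceMap V g).range = eigenSubgroup (DistribSMul.toAddMonoidHom V g) 1 := by
  have hgg (v : V) : g • g • v = v := by
    rw [smul_smul, ← pow_two, ← hg, pow_orderOf_eq_one, one_smul]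
  ext x
  rw [mem_eigenSubgroup, one_smul, AddMonoidHom.mem_range, DistribSMul.toAddMonoidHom_apply]
  constructor
  · rintro ⟨y, rfl⟩
    rw [traceMap_apply_of_orderOf_eq_two hg, smul_add, hgg, add_comm]
  · intro hx
    obtain ⟨y, rfl⟩ := hdiv x
    refine ⟨y, ?_⟩
    have : g • y = y := by
      rw [← sub_eq_zero]
      apply htors
      rw [smul_sub, ← smul_comm, hx, sub_self]
    rw [traceMap_apply_of_orderOf_eq_two hg, this, two_nsmul]

theorem corollaryD (U : ModularUniverse.{u, v}) (d : AdditiveDim U) (V : U.Ob)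
    [DistribMulAction Alt5 (U.Carrier V)]
    (hcompat : ∀ g : Alt5, U.Ar (DistribSMul.toAddMonoidHom (U.Carrier V) g))
    (hfaithful : FaithfulSMul Alt5 (U.Carrier V))
    (hconn : d.IsDimConnected V) (hdim : d.dim V = 3)
    (htors : ∀ x : U.Carrier V, (2 : ℕ) • x = 0 → x = 0) :
    -- `V` is uniquely `2`-divisible, so that `1 / 4` makes sense below
    (Function.Bijective fun x : U.Carrier V => (2 : ℕ) • x) ∧
    -- `α` is any involution, and the conjugacy class of `c` is any class of `5`-cycles
    ∀ α c : Alt5, orderOf α = 2 → orderOf c = 5 →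
      -- `L = tr_α(V)` has dimension one
      d.SubgroupHasDim V (traceMap (U.Carrier V) α).range 1 ∧
      -- `f` is the restriction to `L` of one quarter of the class sum, and `f ^ 2 = f + 1`
      ∃ (f : AddMonoid.End (traceMap (U.Carrier V) α).range) (hf : f * f = f + 1),
        (∀ x : (traceMap (U.Carrier V) α).range,
          (4 : ℕ) • (f x : U.Carrier V) = classSum (U.Carrier V) c (x : U.Carrier V)) ∧
        -- `V` is isomorphic to `Ico(L)`, for every `γ` such that `αγ` is in the class of `c`
        (∃ γ : Alt5, IsIcoPair α γ ∧ IsConj c (α * γ)) ∧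
        ∀ (γ : Alt5) (h : IsIcoPair α γ), IsConj c (α * γ) →
          IsIsoIco h (U.Carrier V) f hf := by
  have hinj : Function.Injective fun x : U.Carrier V => (2 : ℕ) • x := by
    intro x y hxy
    rw [← sub_eq_zero]
    apply htors
    rw [smul_sub, sub_eq_zero]
    exact hxy
  have hdiv : ∀ x : U.Carrier V, ∃ y, (2 : ℕ) • y = x := by
    intro x
    obtain ⟨y, hy⟩ := hconn.surjective (U.mul_int V 2)
      (fun x y hxy => hinj (by simpa [ofNat_zsmul] using hxy)) x
    exact ⟨y, by simpa [ofNat_zsmul] using hy⟩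
  refine ⟨⟨hinj, hdiv⟩, fun α c hα hc => ?_⟩
  obtain ⟨γ, hγ, hcγ⟩ := exists_isIcoPair hα hc
  obtain ⟨β, τ, F⟩ := exists_isIcoFrame hγ
  have hα1 : α ≠ 1 := by
    rintro rfl
    simp at hα
  obtain ⟨hN, hL⟩ := F.trace_eq_zero_and_dim hα1 hcompat hfaithful hconn hdim htors hdiv
  have hrange := range_traceMap (V := U.Carrier V) hα htors hdiv
  rw [← hrange] at hL
  have hmem : ∀ x : U.Carrier V, x ∈ (traceMap (U.Carrier V) α).range ↔ α • x = x := fun x => by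
    rw [hrange, mem_eigenSubgroup, one_smul, DistribSMul.toAddMonoidHom_apply]
  have hfix : ∀ x : (traceMap (U.Carrier V) α).range, α • (x : U.Carrier V) = x :=
    fun x => (hmem x).1 x.2
  -- A quarter of the class sum, realised without division as `(1 + α)γ` for one admissible `γ`.
  let f : AddMonoid.End (traceMap (U.Carrier V) α).range :=
    ((DistribSMul.toAddMonoidHom (U.Carrier V) γ +
      (DistribSMul.toAddMonoidHom (U.Carrier V) α).comp
        (DistribSMul.toAddMonoidHom (U.Carrier V) γ)).comp
      (traceMap (U.Carrier V) α).range.subtype).codRestrict _ (fun x => (hmem _).2 (by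
        simp only [AddMonoidHom.comp_apply, AddMonoidHom.add_apply,
          DistribSMul.toAddMonoidHom_apply, smul_add, F.a_smul_a]
        rw [add_comm]))
  have hfx : ∀ x, (f x : U.Carrier V) = γ • (x : U.Carrier V) + α • γ • (x : U.Carrier V) :=
    fun _ => rfl
  have hf : f * f = f + 1 := by
    refine AddMonoidHom.ext fun x => Subtype.ext ?_
    exact F.add_smul_add_smul htors hN (hfix x)
  have hsum : ∀ x : (traceMap (U.Carrier V) α).range,
      (4 : ℕ) • (f x : U.Carrier V) = classSum (U.Carrier V) c (x : U.Carrier V) := fun x =>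
    (F.classSum_apply htors hN hcγ (hfix x)).symm
  refine ⟨hL, f, hf, hsum, ⟨γ, hγ, hcγ⟩, fun γ' h hcγ' => ?_⟩
  obtain ⟨β', τ', F'⟩ := exists_isIcoFrame h
  obtain ⟨hN', -⟩ := F'.trace_eq_zero_and_dim hα1 hcompat hfaithful hconn hdim htors hdiv
  let _ : Module Zphi (traceMap (U.Carrier V) α).range := zphiModule f hf
  refine F'.exists_addEquiv_ico h htors hdiv hN' (traceMap (U.Carrier V) α).range.subtype
    Subtype.val_injective hfix (fun v hv => ⟨⟨v, (hmem v).2 hv⟩, rfl⟩) fun x => ?_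
  -- `f` was built from `γ`, but four times `(1 + α)γ'` is the same class sum, so cancelling 4
  -- identifies the two operators on `L`.
  have h4 : (4 : ℕ) • (γ' • (x : U.Carrier V) + α • γ' • (x : U.Carrier V)) =
      (4 : ℕ) • (f x : U.Carrier V) := by
    rw [hsum, F'.classSum_apply htors hN' hcγ' (hfix x)]
  rw [show (4 : ℕ) = 2 * 2 from rfl, mul_smul, mul_smul] at h4
  exact (hinj (hinj h4)).trans (congrArg Subtype.val (phi_smul f hf x).symm)
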